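/- \textbf{Setting (random-worlds method).} Let $n,m\ge 0$ be integers. Consider the vocabulary with unary predicates $\mathrm{Copy}$, $\mathrm{Access}$, $\mathrm{Similar}_1,\dots,\mathrm{Similar}_n$, $\mathrm{EA}_1,\dots,\mathrm{EA}_m$ (levels of similarity, categories of evidence of access) and one constant $\tilde x$ (the defendant's work). A world of size $N$ is an interpretation of all these symbols on the domain $\{1,\dots,N\}$. For a vector $\vec\tau=(\tau_k)_{k\in\mathbb N}$ of positive tolerances, a formula $\lVert\varphi(x)\mid\theta(x)\rVert_x\approx_k a$ holds in a world if the proportion of elements satisfying $\varphi$ among those satisfying $\theta$ differs from $a$ by at most $\tau_k$, or if no element satisfies $\theta$. Let $\mathrm{Pr}^{\vec\tau}_N(\varphi\mid K)$ be the fraction of worlds satisfying $\varphi$ among the worlds of size $N$ satisfying $K$ with tolerances $\vec\tau$. The degree of belief $\mathrm{Pr}_\infty(\varphi\mid K)$ exists and equals $p$ if, for all sufficiently small $\vec\tau$ and then all sufficiently large $N$, some world satisfies $K$, and $\lim_{\vec\tau\to0}\liminf_{N\to\infty}\mathrm{Pr}^{\vec\tau}_N(\varphi\mid K)=\lim_{\vec\tau\to0}\limsup_{N\to\infty}\mathrm{Pr}^{\vec\tau}_N(\varphi\mid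 K)=p$. Write $\psi_i(x)=\mathrm{Similar}_i(x)\wedge\bigwedge_{k>i}\neg\mathrm{Similar}_k(x)$ and $\chi_j(x)=\mathrm{EA}_j(x)\wedge\bigwedge_{l\ne j}\neg\mathrm{EA}_l(x)$. Let $\alpha_i,\beta_{i,j}\in[0,1]$ ($1\le i\le n$, $1\le j\le m$) satisfy $\alpha_{i+1}\ge\alpha_i$, $\beta_{i,j+1}\ge\beta_{i,j}$ and $\beta_{i+1,j}\ge\beta_{i,j}$. Let $\mathrm{KB}$ be the conjunction of (a) $\forall x\,(\mathrm{Copy}(x)\Rightarrow\mathrm{Access}(x))$; (b) $\forall x\,(\mathrm{Similar}_{i+1}(x)\Rightarrow\mathrm{Similar}_i(x))$ for $1\le i<n$; (c) $\lVert\mathrm{Copy}(x)\mid\mathrm{Access}(x)\wedge\psi_i(x)\rVert_x\approx\alpha_i$ for $1\le i\le n$; (d) $\lVert\mathrm{Access}(x)\mid\psi_i(x)\wedge\chi_j(x)\rVert_x\approx\beta_{i,j}$ for $1\le i\le n$, $1\le j\le m$; where each sign $\approx$ carries its own, arbitrary, tolerance index. Let $\mathrm{KB}_{i,j}=\psi_i(\tilde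 x)\wedge\chi_j(\tilde x)$, and let $\lambda\in\mathbb R$. \textbf{Proposition (inverse ratio rule).} For all $i,j$ the degree of belief $\mathrm{Pr}_\infty(\mathrm{Copy}(\tilde x)\mid\mathrm{KB}\wedge\mathrm{KB}_{i,j})$ exists and equals $\alpha_i\beta_{i,j}$. Moreover, with the convention $\min\emptyset=\infty$: (1) If $j\ge j'$, then $\min\{i:\mathrm{Pr}_\infty(\mathrm{Copy}(\tilde x)\mid\mathrm{KB}\wedge\mathrm{KB}_{i,j})>\lambda\}\le\min\{i:\mathrm{Pr}_\infty(\mathrm{Copy}(\tilde x)\mid\mathrm{KB}\wedge\mathrm{KB}_{i,j'})>\lambda\}$. (2) If $i\ge i'$, then $\min\{j:\mathrm{Pr}_\infty(\mathrm{Copy}(\tilde x)\mid\mathrm{KB}\wedge\mathrm{KB}_{i,j})>\lambda\}\le\min\{j:\mathrm{Pr}_\infty(\mathrm{Copy}(\tilde x)\mid\mathrm{KB}\wedge\mathrm{KB}_{i',j})>\lambda\}$. -/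

import Mathlib

open Filter Topology

namespace RandomWorlds

/-- A possible world with domain `Fin N` for the vocabulary consisting of the unary predicates
`Copy`, `Access`, `Similar_i` (`n` similarity levels), `EA_j` (`m` categories of evidence of
access) and one constant, the defendant's work. A world is an arbitrary interpretation of all of
these symbols. Levels and categories are indexed by `Fin n` and `Fin m`. -/
@[ext]
structure World (n m N : ℕ) where
  copy : Fin N → Prop
  access : Fin N → Prop
  similar : Fin n → Fin N → Prop
  ea : Fin m → Fin N → Prop
  defendant : Fin N

/-- There are finitely many worlds of each domain size, so counting them is meaningful. -/
instance finite_world (n m N : ℕ) : Finite (World n m N) :=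
  Finite.of_injective
    (fun w : World n m N => (w.copy, w.access, w.similar, w.ea, w.defendant)) (by
      intro v w h
      simp only [Prod.mk.injEq] at h
      exact World.ext h.1 h.2.1 h.2.2.1 h.2.2.2.1 h.2.2.2.2)

/-- An assertion: its truth depends on the tolerance vector and on the world (of any size). -/
abbrev Assertion (n m : ℕ) : Type := (ℕ → ℝ) → ∀ N : ℕ, World n m N → Prop

/-- Conjunction of assertions. -/
def Assertion.and {n m : ℕ} (φ ψ : Assertion n m) : Assertion n m :=
  fun τ N w => φ τ N w ∧ ψ τ N w

/-- The conditional proportion of the domain elements satisfying `φ` among those satisfying `θ`;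
only meaningful when some element satisfies `θ`. -/
noncomputable def proportion {N : ℕ} (φ θ : Fin N → Prop) : ℝ :=
  ({x | φ x ∧ θ x}.ncard : ℝ) / ({x | θ x}.ncard : ℝ)

/-- The formula `‖φ | θ‖ₓ ≈ a` read with tolerance `ε`: the conditional proportion is within `ε`
of `a`. As is standard (clear the denominator), it holds when no element satisfies `θ`. -/
def ProportionApprox {N : ℕ} (φ θ : Fin N → Prop) (a ε : ℝ) : Prop :=
  (∃ x, θ x) → |proportion φ θ - a| ≤ ε

/-- The fraction, among the worlds of size `N` satisfying `KB` with tolerance vector `τ`,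
of those which also satisfy `φ`; only meaningful when some world satisfies `KB`. -/
noncomputable def prAt {n m : ℕ} (φ KB : Assertion n m) (τ : ℕ → ℝ) (N : ℕ) : ℝ :=
  ({w : World n m N | φ τ N w ∧ KB τ N w}.ncard : ℝ) /
    ({w : World n m N | KB τ N w}.ncard : ℝ)

/-- The filter of tolerance vectors with positive entries tending to zero. -/
def toleranceToZero : Filter (ℕ → ℝ) := 𝓝[{τ | ∀ k, 0 < τ k}] 0

/-- For all sufficiently small tolerances and then all sufficiently large domain sizes,
some world satisfies `KB`. -/
def EventuallyConsistent {n m : ℕ} (KB : Assertion n m) : Prop :=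
  ∀ᶠ τ in toleranceToZero, ∀ᶠ N : ℕ in atTop, ∃ w : World n m N, KB τ N w

/-- The degree of belief `Pr_∞(φ | KB)` exists and equals `p`. -/
def HasDegreeOfBelief {n m : ℕ} (φ KB : Assertion n m) (p : ℝ) : Prop :=
  EventuallyConsistent KB ∧
  Tendsto (fun τ => liminf (fun N => prAt φ KB τ N) atTop) toleranceToZero (𝓝 p) ∧
  Tendsto (fun τ => limsup (fun N => prAt φ KB τ N) atTop) toleranceToZero (𝓝 p)

/-- `Pr_∞(φ | KB) > l` : the degree of belief exists and is greater than `l`. -/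
def BeliefExceeds {n m : ℕ} (φ KB : Assertion n m) (l : ℝ) : Prop :=
  ∃ p, HasDegreeOfBelief φ KB p ∧ l < p

/-- `i` is exactly the maximal similarity level of `x`. -/
def World.ExactSim {n m N : ℕ} (w : World n m N) (i : Fin n) (x : Fin N) : Prop :=
  w.similar i x ∧ ∀ k, i < k → ¬ w.similar k x

/-- `j` is the only category of evidence of access that is present for `x`. -/
def World.ExactEA {n m N : ℕ} (w : World n m N) (j : Fin m) (x : Fin N) : Prop :=
  w.ea j x ∧ ∀ l, l ≠ j → ¬ w.ea l x

/-- The knowledge base `KB`. The relation sign `≈` in the proportion statement of level `i` uses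
the component `s i` of the tolerance vector, and the one of the pair `(i, j)` uses `t i j`. -/
def KB {n m : ℕ} (α : Fin n → ℝ) (β : Fin n → Fin m → ℝ)
    (s : Fin n → ℕ) (t : Fin n → Fin m → ℕ) : Assertion n m := fun τ _ w =>
  (∀ x, w.copy x → w.access x) ∧
  (∀ i k : Fin n, (k : ℕ) = (i : ℕ) + 1 → ∀ x, w.similar k x → w.similar i x) ∧
  (∀ i, ProportionApprox w.copy (fun x => w.access x ∧ w.ExactSim i x) (α i) (τ (s i))) ∧
  (∀ i j, ProportionApprox w.access (fun x => w.ExactSim i x ∧ w.ExactEA j x)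
    (β i j) (τ (t i j)))

/-- The information about the defendant's work: its exact similarity level is `i` and its only
category of evidence of access is `j`. -/
def KBdef {n m : ℕ} (i : Fin n) (j : Fin m) : Assertion n m := fun _ _ w =>
  w.ExactSim i w.defendant ∧ w.ExactEA j w.defendant

/-- The assertion that the defendant's work was produced by copying. -/
def CopyDef {n m : ℕ} : Assertion n m := fun _ _ w => w.copy w.defendant

open Classical in
/-- The least index satisfying `P`, and `⊤` if there is none. -/
noncomputable def minIndex {n : ℕ} (P : Fin n → Prop) : WithTop (Fin n) :=
  (Finset.univ.filter P).min

end RandomWorlds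

namespace RandomWorlds

/-! No asymptotic count of worlds is needed: whenever the evidence is consistent, `prAt` is within
`τ (s i) + τ (t i j)` of `α i * β i j` at every size `N` (`abs_prAt_sub_le`). The reason is
symmetry. If an involution exchanges the defendant with the members of its reference class, the
fraction of worlds in which the defendant has a property is the average over worlds of the
proportion of that property in the class, and the knowledge base pins each such proportion. This is
used once for access and once for copying given access, and the two fractions multiply. Consistency
for large `N` comes from one explicit world (`eventually_exists_world`). The two monotonicity claims
then compare products of nonnegative reals. -/

/-! ### Double counting by exchange. -/

/-- Double counting along an involution `σ` of `W × Fin N` which exchanges the distinguished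
element `d w` with another element of its reference class `C w`. -/
theorem abs_ncard_sub_le_of_exchange {W : Type*} [Finite W] {N : ℕ} (S : Set W) (d : W → Fin N)
    (P C : W → Fin N → Prop) (σ : W × Fin N → W × Fin N) (hσ : Function.Involutive σ)
    (hd : ∀ w ∈ S, C w (d w))
    (hS : ∀ w x, w ∈ S → C w x → (σ (w, x)).1 ∈ S ∧ C (σ (w, x)).1 (σ (w, x)).2 ∧
      C (σ (w, x)).1 = C w ∧ (P (σ (w, x)).1 (σ (w, x)).2 ↔ P w (d w)))
    {a ε : ℝ} (hp : ∀ w ∈ S, |proportion (P w) (C w) - a| ≤ ε) :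
    |({w | w ∈ S ∧ P w (d w)}.ncard : ℝ) - a * (S.ncard : ℝ)| ≤ ε * (S.ncard : ℝ) := by
  classical
  have := Fintype.ofFinite W
  set T : Finset W := Finset.univ.filter (· ∈ S) with hT
  have hTS : ∀ w, w ∈ T ↔ w ∈ S := fun w => by simp [hT]
  have hScard : S.ncard = T.card := by
    rw [← Set.ncard_coe_finset]; congr 1; ext w; simp [hTS]
  have hcard : ({w | w ∈ S ∧ P w (d w)}.ncard : ℝ) = ∑ w ∈ T, if P w (d w) then (1 : ℝ) else 0 := by
    rw [Finset.sum_boole, ← Set.ncard_coe_finset]; congr 2; ext w; simp [hTS]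
  have hC : ∀ w ∈ T, ((Finset.univ.filter (C w)).card : ℝ) ≠ 0 := fun w hw => by
    rw [Nat.cast_ne_zero, Finset.card_ne_zero]
    exact ⟨d w, by simpa using hd w ((hTS w).1 hw)⟩
  have hprop : ∀ w, proportion (P w) (C w) =
      ∑ x with C w x, (if P w x then (1 : ℝ) else 0) / ((Finset.univ.filter (C w)).card : ℝ) := by
    intro w
    rw [← Finset.sum_div, Finset.sum_boole, Finset.filter_filter, proportion,
      ← Set.ncard_coe_finset, ← Set.ncard_coe_finset]
    congr 3 <;> ext x <;> simp [and_comm]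
  -- The indicator at `d w` is spread evenly over the class of `w`, so both sides become sums over
  -- pairs `(w, x)` with `C w x`.
  have hconst : ∀ w ∈ T, (if P w (d w) then (1 : ℝ) else 0) =
      ∑ x with C w x,
        (if P w (d w) then (1 : ℝ) else 0) / ((Finset.univ.filter (C w)).card : ℝ) := by
    intro w hw
    rw [Finset.sum_const, nsmul_eq_mul, mul_div_cancel₀ _ (hC w hw)]
  have key : ({w | w ∈ S ∧ P w (d w)}.ncard : ℝ) = ∑ w ∈ T, proportion (P w) (C w) := by
    rw [hcard, Finset.sum_congr rfl hconst, Finset.sum_congr rfl fun w _ => hprop w,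
      Finset.sum_sigma', Finset.sum_sigma']
    have hmem : ∀ z ∈ T.sigma fun w => Finset.univ.filter (C w), z.1 ∈ S ∧ C z.1 z.2 := by
      intro z hz; simpa [hTS] using hz
    have hmaps : ∀ z ∈ T.sigma fun w => Finset.univ.filter (C w),
        (⟨(σ (z.1, z.2)).1, (σ (z.1, z.2)).2⟩ : (_ : W) × Fin N) ∈
          T.sigma fun w => Finset.univ.filter (C w) := by
      intro z hz
      obtain ⟨h1, h2, -⟩ := hS z.1 z.2 (hmem z hz).1 (hmem z hz).2
      simpa [hTS] using ⟨h1, h2⟩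
    refine Finset.sum_bij' (fun z _ => ⟨(σ (z.1, z.2)).1, (σ (z.1, z.2)).2⟩)
      (fun z _ => ⟨(σ (z.1, z.2)).1, (σ (z.1, z.2)).2⟩) hmaps hmaps ?_ ?_ ?_
    · intro z _; simp [hσ (z.1, z.2)]
    · intro z _; simp [hσ (z.1, z.2)]
    -- `σ` turns the term at `d w` into the term at a class member; the class is unchanged, hence so
    -- is the weight.
    · intro z hz
      obtain ⟨-, -, h3, h4⟩ := hS z.1 z.2 (hmem z hz).1 (hmem z hz).2
      simp only [h4]
      simp only [h3]
  rw [key, hScard]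
  calc |∑ w ∈ T, proportion (P w) (C w) - a * (T.card : ℝ)|
      = |∑ w ∈ T, (proportion (P w) (C w) - a)| := by
        rw [Finset.sum_sub_distrib, Finset.sum_const, nsmul_eq_mul, mul_comm a]
    _ ≤ ∑ w ∈ T, |proportion (P w) (C w) - a| := Finset.abs_sum_le_sum_abs _ _
    _ ≤ ∑ _w ∈ T, ε := Finset.sum_le_sum fun w hw => hp w ((hTS w).1 hw)
    _ = ε * (T.card : ℝ) := by rw [Finset.sum_const, nsmul_eq_mul, mul_comm]

/-! ### Symmetries of the knowledge base and the bound at finite size. -/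

/-- Conditional proportions are invariant under a permutation preserving the reference class. -/
theorem proportion_comp_perm {N : ℕ} (e : Equiv.Perm (Fin N)) (φ θ : Fin N → Prop)
    (h : ∀ x, θ (e x) ↔ θ x) : proportion (fun x => φ (e x)) θ = proportion φ θ := by
  have : {x | φ (e x) ∧ θ x} = e ⁻¹' {x | φ x ∧ θ x} := by ext x; simp [h]
  rw [proportion, proportion, this, Set.ncard_preimage_of_injective_subset_range e.injective
    (by simp)]

theorem World.ExactSim.unique {n m N : ℕ} {w : World n m N} {i k : Fin n} {x : Fin N}
    (hi : w.ExactSim i x) (hk : w.ExactSim k x) : i = k := by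
  rcases lt_trichotomy i k with h | h | h
  · exact absurd hk.1 (hi.2 k h)
  · exact h
  · exact absurd hi.1 (hk.2 i h)

theorem World.ExactEA.unique {n m N : ℕ} {w : World n m N} {j l : Fin m} {x : Fin N}
    (hj : w.ExactEA j x) (hl : w.ExactEA l x) : j = l := by
  by_contra h
  exact hl.2 j h hj.1

/-- The world obtained by moving the constant to `x`. -/
def World.moveDefendant {n m N : ℕ} (w : World n m N) (x : Fin N) : World n m N :=
  { w with defendant := x }

/-- The world obtained by exchanging the copying status of `x` and of the defendant's work. -/
def World.swapCopy {n m N : ℕ} (w : World n m N) (x : Fin N) : World n m N :=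
  { w with copy := fun y => w.copy (Equiv.swap x w.defendant y) }

section Counting

variable {n m : ℕ} {α : Fin n → ℝ} {β : Fin n → Fin m → ℝ} {s : Fin n → ℕ}
  {t : Fin n → Fin m → ℕ}

theorem KB_moveDefendant {τ : ℕ → ℝ} {N : ℕ} {w : World n m N} (x : Fin N)
    (h : KB α β s t τ N w) : KB α β s t τ N (w.moveDefendant x) := h

/-- Both elements are accessed and have the same exact level, so the transposition preserves every
class conditioning `copy`, and all of those proportions survive. -/
theorem KB_swapCopy {τ : ℕ → ℝ} {N : ℕ} {w : World n m N} {i : Fin n} {x : Fin N}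
    (h : KB α β s t τ N w) (hx : w.access x ∧ w.ExactSim i x)
    (hd : w.access w.defendant ∧ w.ExactSim i w.defendant) :
    KB α β s t τ N (w.swapCopy x) := by
  have inv : ∀ q : Fin N → Prop, (q x ↔ q w.defendant) →
      ∀ y, q (Equiv.swap x w.defendant y) ↔ q y := by
    intro q hq y
    by_cases h1 : y = x
    · subst h1; rw [Equiv.swap_apply_left]; exact hq.symm
    · by_cases h2 : y = w.defendant
      · subst h2; rw [Equiv.swap_apply_right]; exact hq
      · rw [Equiv.swap_apply_of_ne_of_ne h1 h2]
  refine ⟨fun y hy => (inv w.access (iff_of_true hx.1 hd.1) y).1 (h.1 _ hy), h.2.1, ?_, h.2.2.2⟩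
  intro k hk
  have hcls : ∀ y, (w.access (Equiv.swap x w.defendant y) ∧
      w.ExactSim k (Equiv.swap x w.defendant y)) ↔ (w.access y ∧ w.ExactSim k y) := by
    refine inv (fun y => w.access y ∧ w.ExactSim k y) ?_
    by_cases hik : i = k
    · subst hik; exact iff_of_true hx hd
    · exact iff_of_false (fun h' => hik (hx.2.unique h'.2)) (fun h' => hik (hd.2.unique h'.2))
  have := h.2.2.1 k hk
  rwa [← proportion_comp_perm (Equiv.swap x w.defendant) w.copy _ hcls] at this

theorem abs_prAt_sub_le {τ : ℕ → ℝ} {N : ℕ} {i : Fin n} {j : Fin m} (hα : α i ∈ Set.Icc (0 : ℝ) 1)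
    (hs : 0 < τ (s i))
    (hne : ∃ w : World n m N, ((KB α β s t).and (KBdef i j)) τ N w) :
    |prAt CopyDef ((KB α β s t).and (KBdef i j)) τ N - α i * β i j| ≤ τ (s i) + τ (t i j) := by
  set S : Set (World n m N) := {w | ((KB α β s t).and (KBdef i j)) τ N w} with hS
  set A : Set (World n m N) := {w | w ∈ S ∧ w.access w.defendant} with hA
  have h1 : |(A.ncard : ℝ) - β i j * (S.ncard : ℝ)| ≤ τ (t i j) * (S.ncard : ℝ) := by
    -- The knowledge base does not mention the constant, so the constant can move freely within the
    -- class.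
    refine abs_ncard_sub_le_of_exchange S World.defendant World.access
      (fun w x => w.ExactSim i x ∧ w.ExactEA j x)
      (fun p => (p.1.moveDefendant p.2, p.1.defendant)) (fun p => rfl) (fun w hw => hw.2)
      (fun w x hw hx => ⟨⟨KB_moveDefendant x hw.1, hx⟩, hw.2, rfl, Iff.rfl⟩)
      (fun w hw => hw.1.2.2.2 i j ⟨_, hw.2⟩)
  have h2 : |({w | w ∈ A ∧ w.copy w.defendant}.ncard : ℝ) - α i * (A.ncard : ℝ)| ≤
      τ (s i) * (A.ncard : ℝ) := by
    -- Here the class ignores the evidence category, so moving the constant could violate `KBdef`.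
    -- The copying statuses are exchanged instead, with the constant fixed.
    refine abs_ncard_sub_le_of_exchange A World.defendant World.copy
      (fun w x => w.access x ∧ w.ExactSim i x)
      (fun p => (p.1.swapCopy p.2, p.2)) ?_ (fun w hw => ⟨hw.2, hw.1.2.1⟩) ?_
      (fun w hw => hw.1.1.2.2.1 i ⟨_, hw.2, hw.1.2.1⟩)
    · rintro ⟨w, x⟩
      simp [World.swapCopy]
    · intro w x hw hx
      refine ⟨⟨⟨KB_swapCopy hw.1.1 hx ⟨hw.2, hw.1.2.1⟩, hw.1.2⟩, hw.2⟩, hx, rfl, ?_⟩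
      simp [World.swapCopy]
  -- Copying implies access, so restricting to `A` loses no world.
  have h3 : {w : World n m N | CopyDef τ N w ∧ ((KB α β s t).and (KBdef i j)) τ N w} =
      {w | w ∈ A ∧ w.copy w.defendant} := by
    ext w
    exact ⟨fun h => ⟨⟨h.2, h.2.1.1 _ h.1⟩, h.1⟩, fun h => ⟨h.2, h.1.1⟩⟩
  have hSpos : (0 : ℝ) < S.ncard := by
    rw [Nat.cast_pos, Set.ncard_pos]; exact hne
  have hAS : (A.ncard : ℝ) ≤ S.ncard := by
    rw [Nat.cast_le]; exact Set.ncard_le_ncard fun w hw => hw.1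
  rw [prAt, h3, ← hS]
  set c : ℝ := ({w | w ∈ A ∧ w.copy w.defendant}.ncard : ℝ)
  have hdiv : c / S.ncard - α i * β i j = (c - α i * β i j * S.ncard) / S.ncard := by
    field_simp
  rw [hdiv, abs_div, abs_of_pos hSpos, div_le_iff₀ hSpos]
  calc |c - α i * β i j * S.ncard|
      = |(c - α i * A.ncard) + α i * (A.ncard - β i j * S.ncard)| := by congr 1; ring
    _ ≤ |c - α i * A.ncard| + |α i * (A.ncard - β i j * S.ncard)| := abs_add_le _ _
    _ ≤ τ (s i) * S.ncard + 1 * (τ (t i j) * S.ncard) := by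
      rw [abs_mul, abs_of_nonneg hα.1]
      refine add_le_add (h2.trans (mul_le_mul_of_nonneg_left hAS hs.le)) ?_
      exact mul_le_mul hα.2 h1 (abs_nonneg _) zero_le_one
    _ = (τ (s i) + τ (t i j)) * S.ncard := by ring

end Counting

/-! ### Consistency for large domains. -/

section Consistency

theorem ncard_val_lt {N a : ℕ} (h : a ≤ N) : {x : Fin N | (x : ℕ) < a}.ncard = a := by
  have : {x : Fin N | (x : ℕ) < a} = Set.range (Fin.castLE h) := by
    ext x
    exact ⟨fun hx => ⟨⟨x, hx⟩, rfl⟩, by rintro ⟨y, rfl⟩; exact y.2⟩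
  rw [this, ← Set.image_univ, Set.ncard_image_of_injective _ (Fin.castLE_injective h),
    Set.ncard_univ, Nat.card_fin]

theorem abs_floor_mul_div_sub_le {a ε : ℝ} (ha : 0 ≤ a) {M : ℕ} (hM : 0 < M) (h : 1 ≤ ε * M) :
    |(⌊a * M⌋₊ : ℝ) / M - a| ≤ ε := by
  have hM' : (0 : ℝ) < M := Nat.cast_pos.2 hM
  have h1 := Nat.floor_le (mul_nonneg ha hM'.le)
  have h2 := Nat.lt_floor_add_one (a * M)
  have : (⌊a * M⌋₊ : ℝ) / M - a = (⌊a * M⌋₊ - a * M) / M := by field_simp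
  rw [this, abs_div, abs_of_pos hM', div_le_iff₀ hM', abs_le]
  constructor <;> linarith

theorem floor_mul_le_self {a : ℝ} (ha : a ≤ 1) (M : ℕ) : ⌊a * M⌋₊ ≤ M := by
  refine Nat.floor_le_of_le ?_
  exact mul_le_of_le_one_left (Nat.cast_nonneg M) ha

variable {n m : ℕ} {α : Fin n → ℝ} {β : Fin n → Fin m → ℝ} {s : Fin n → ℕ}
  {t : Fin n → Fin m → ℕ}

/-- The world all of whose elements have exact level `i` and sole category `j`, with `a` accessed
elements, `c` of them copied (for `c ≤ a`). -/
def uniformWorld {N : ℕ} (i : Fin n) (j : Fin m) (a c : ℕ) (d : Fin N) : World n m N where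
  copy x := (x : ℕ) < c
  access x := (x : ℕ) < a
  similar k _ := k ≤ i
  ea l _ := l = j
  defendant := d

theorem uniformWorld_exactSim {N : ℕ} {i k : Fin n} {j : Fin m} {a c : ℕ} {d x : Fin N} :
    (uniformWorld i j a c d).ExactSim k x ↔ k = i :=
  ⟨fun h => le_antisymm h.1 (not_lt.1 fun hk => h.2 i hk le_rfl),
    fun h => h ▸ ⟨le_rfl, fun _ hk => not_le.2 hk⟩⟩

theorem uniformWorld_exactEA {N : ℕ} {i : Fin n} {j l : Fin m} {a c : ℕ} {d x : Fin N} :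
    (uniformWorld i j a c d).ExactEA l x ↔ l = j :=
  ⟨fun h => h.1, fun h => h ▸ ⟨rfl, fun _ hk => hk⟩⟩

/-- Only level `i` and category `j` are inhabited; every other proportion statement holds vacuously.
-/
theorem KB_uniformWorld {N : ℕ} {i : Fin n} {j : Fin m} {a c : ℕ} (d : Fin N) {τ : ℕ → ℝ}
    (hc : c ≤ a) (ha : a ≤ N) (h1 : 0 < a → |(c : ℝ) / a - α i| ≤ τ (s i))
    (h2 : |(a : ℝ) / N - β i j| ≤ τ (t i j)) :
    KB α β s t τ N (uniformWorld i j a c d) := by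
  refine ⟨fun x hx => lt_of_lt_of_le hx hc, ?_, ?_, ?_⟩
  · intro k l hkl x hx
    refine le_trans ?_ hx
    rw [Fin.le_def]; omega
  · rintro k ⟨x, hx, hk⟩
    obtain rfl := uniformWorld_exactSim.1 hk
    have hx' : (x : ℕ) < a := hx
    have e1 : {y | (uniformWorld k j a c d).copy y ∧ (uniformWorld k j a c d).access y ∧
        (uniformWorld k j a c d).ExactSim k y} = {y : Fin N | (y : ℕ) < c} := by
      ext y
      exact ⟨fun h => h.1, fun h => ⟨h, lt_of_lt_of_le h hc, uniformWorld_exactSim.2 rfl⟩⟩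
    have e2 : {y | (uniformWorld k j a c d).access y ∧
        (uniformWorld k j a c d).ExactSim k y} = {y : Fin N | (y : ℕ) < a} := by
      ext y
      exact ⟨fun h => h.1, fun h => ⟨h, uniformWorld_exactSim.2 rfl⟩⟩
    rw [proportion, e1, e2, ncard_val_lt ha, ncard_val_lt (hc.trans ha)]
    exact h1 (by omega)
  · rintro k l ⟨x, hk, hl⟩
    obtain rfl := uniformWorld_exactSim.1 hk
    obtain rfl := uniformWorld_exactEA.1 hl
    have e1 : {y | (uniformWorld k l a c d).access y ∧ (uniformWorld k l a c d).ExactSim k y ∧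
        (uniformWorld k l a c d).ExactEA l y} = {y : Fin N | (y : ℕ) < a} := by
      ext y
      exact ⟨fun h => h.1, fun h => ⟨h, uniformWorld_exactSim.2 rfl, uniformWorld_exactEA.2 rfl⟩⟩
    have e2 : {y | (uniformWorld k l a c d).ExactSim k y ∧
        (uniformWorld k l a c d).ExactEA l y} = Set.univ := by
      ext y
      exact ⟨fun _ => trivial, fun _ => ⟨uniformWorld_exactSim.2 rfl, uniformWorld_exactEA.2 rfl⟩⟩
    rw [proportion, e1, e2, ncard_val_lt ha, Set.ncard_univ, Nat.card_fin]
    exact h2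

theorem eventually_exists_world {τ : ℕ → ℝ} (hτ : ∀ k, 0 < τ k) {i : Fin n} {j : Fin m}
    (hα : α i ∈ Set.Icc (0 : ℝ) 1) (hβ : β i j ∈ Set.Icc (0 : ℝ) 1) :
    ∀ᶠ N : ℕ in atTop, ∃ w : World n m N, ((KB α β s t).and (KBdef i j)) τ N w := by
  have hlarge : ∀ k, ∀ᶠ M : ℕ in atTop, 1 ≤ τ k * M := fun k =>
    (tendsto_natCast_atTop_atTop.const_mul_atTop (hτ k)).eventually_ge_atTop 1
  -- If `β i j = 0` nothing is accessed and the copying statement is vacuous; otherwise the accessed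
  -- class grows without bound, so rounding falls below the tolerance.
  have haccess : ∀ᶠ N : ℕ in atTop, 0 < ⌊β i j * N⌋₊ → 1 ≤ τ (s i) * ⌊β i j * N⌋₊ := by
    rcases hβ.1.eq_or_lt with h0 | h0
    · simp [← h0]
    · have : Tendsto (fun N : ℕ => ⌊β i j * N⌋₊) atTop atTop :=
        tendsto_nat_floor_atTop.comp (tendsto_natCast_atTop_atTop.const_mul_atTop h0)
      exact (this.eventually (hlarge (s i))).mono fun N h _ => h
  filter_upwards [haccess, hlarge (t i j), eventually_gt_atTop 0] with N h1 h2 hN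
  refine ⟨uniformWorld i j ⌊β i j * N⌋₊ ⌊α i * (⌊β i j * N⌋₊ : ℕ)⌋₊ ⟨0, hN⟩,
    KB_uniformWorld _ (floor_mul_le_self hα.2 _) (floor_mul_le_self hβ.2 _)
      (fun h => abs_floor_mul_div_sub_le hα.1 h (h1 h)) (abs_floor_mul_div_sub_le hβ.1 hN h2),
    uniformWorld_exactSim.2 rfl, uniformWorld_exactEA.2 rfl⟩

end Consistency

/-! ### Limits, uniqueness and thresholds. -/

theorem abs_liminf_sub_le_and_abs_limsup_sub_le {u : ℕ → ℝ} {p δ : ℝ}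
    (h : ∀ᶠ N in atTop, |u N - p| ≤ δ) :
    |liminf u atTop - p| ≤ δ ∧ |limsup u atTop - p| ≤ δ := by
  have hlo : ∀ᶠ N in atTop, p - δ ≤ u N := h.mono fun N hN => by linarith [(abs_le.1 hN).1]
  have hup : ∀ᶠ N in atTop, u N ≤ p + δ := h.mono fun N hN => by linarith [(abs_le.1 hN).2]
  have b1 : IsBoundedUnder (· ≤ ·) atTop u := isBoundedUnder_of_eventually_le hup
  have b2 : IsBoundedUnder (· ≥ ·) atTop u := isBoundedUnder_of_eventually_ge hlo
  have l1 : p - δ ≤ liminf u atTop := le_liminf_of_le b1.isCoboundedUnder_ge hlo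
  have l2 : limsup u atTop ≤ p + δ := limsup_le_of_le b2.isCoboundedUnder_le hup
  have l3 := liminf_le_limsup b1 b2
  constructor <;> rw [abs_le] <;> constructor <;> linarith

theorem tendsto_toleranceToZero_apply (k : ℕ) :
    Tendsto (fun τ : ℕ → ℝ => τ k) toleranceToZero (𝓝 0) :=
  ((continuous_apply k).tendsto (0 : ℕ → ℝ)).mono_left nhdsWithin_le_nhds

/-- Nontriviality of the filter makes the degree of belief unique, so `BeliefExceeds` reduces to an
inequality. -/
instance toleranceToZero_neBot : toleranceToZero.NeBot := by
  rw [toleranceToZero, ← mem_closure_iff_nhdsWithin_neBot]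
  have : {τ : ℕ → ℝ | ∀ k, 0 < τ k} = Set.pi Set.univ fun _ => Set.Ioi 0 := by ext; simp
  rw [this, closure_pi_set]
  simp only [closure_Ioi, Set.mem_univ_pi, Set.mem_Ici]
  exact fun _ => le_rfl

theorem HasDegreeOfBelief.unique {n m : ℕ} {φ K : Assertion n m} {p q : ℝ}
    (hp : HasDegreeOfBelief φ K p) (hq : HasDegreeOfBelief φ K q) : p = q :=
  tendsto_nhds_unique hp.2.1 hq.2.1

theorem HasDegreeOfBelief.beliefExceeds_iff {n m : ℕ} {φ K : Assertion n m} {p l : ℝ}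
    (hp : HasDegreeOfBelief φ K p) : BeliefExceeds φ K l ↔ l < p :=
  ⟨fun ⟨_, hq, h⟩ => hp.unique hq ▸ h, fun h => ⟨p, hp, h⟩⟩

theorem hasDegreeOfBelief_copyDef {n m : ℕ} {α : Fin n → ℝ} {β : Fin n → Fin m → ℝ}
    (s : Fin n → ℕ) (t : Fin n → Fin m → ℕ) {i : Fin n} {j : Fin m}
    (hα : α i ∈ Set.Icc (0 : ℝ) 1) (hβ : β i j ∈ Set.Icc (0 : ℝ) 1) :
    HasDegreeOfBelief CopyDef ((KB α β s t).and (KBdef i j)) (α i * β i j) := by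
  have hpos : ∀ᶠ τ in toleranceToZero, ∀ k, 0 < τ k := eventually_mem_nhdsWithin
  have hbound : ∀ᶠ τ in toleranceToZero, ∀ᶠ N in atTop,
      |prAt CopyDef ((KB α β s t).and (KBdef i j)) τ N - α i * β i j| ≤ τ (s i) + τ (t i j) :=
    hpos.mono fun τ hτ => (eventually_exists_world hτ hα hβ).mono fun N hN =>
      abs_prAt_sub_le hα (hτ _) hN
  have hlim : Tendsto (fun τ : ℕ → ℝ => τ (s i) + τ (t i j)) toleranceToZero (𝓝 0) := by
    simpa using (tendsto_toleranceToZero_apply (s i)).add (tendsto_toleranceToZero_apply (t i j))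
  refine ⟨hpos.mono fun τ hτ => eventually_exists_world hτ hα hβ, ?_, ?_⟩ <;>
    rw [tendsto_iff_dist_tendsto_zero]
  · exact squeeze_zero' (Eventually.of_forall fun _ => dist_nonneg)
      (hbound.mono fun τ h => (abs_liminf_sub_le_and_abs_limsup_sub_le h).1) hlim
  · exact squeeze_zero' (Eventually.of_forall fun _ => dist_nonneg)
      (hbound.mono fun τ h => (abs_liminf_sub_le_and_abs_limsup_sub_le h).2) hlim

theorem minIndex_le_minIndex {n : ℕ} {P Q : Fin n → Prop} (h : ∀ i, Q i → P i) :
    minIndex P ≤ minIndex Q := by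
  classical
  exact Finset.min_mono fun i hi => by simpa using h i (by simpa using hi)

end RandomWorlds

theorem proposition1 {n m : ℕ} (α : Fin n → ℝ) (β : Fin n → Fin m → ℝ)
    (s : Fin n → ℕ) (t : Fin n → Fin m → ℕ) (lam : ℝ)
    (hα : ∀ i, α i ∈ Set.Icc (0 : ℝ) 1) (hβ : ∀ i j, β i j ∈ Set.Icc (0 : ℝ) 1)
    (hα_mono : Monotone α)
    (hβ_mono_ea : ∀ i, Monotone (fun j => β i j))
    (hβ_mono_sim : ∀ j, Monotone (fun i => β i j)) :
    (∀ i j, RandomWorlds.HasDegreeOfBelief RandomWorlds.CopyDef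
      ((RandomWorlds.KB α β s t).and (RandomWorlds.KBdef i j)) (α i * β i j)) ∧
    (∀ j j' : Fin m, j' ≤ j →
      RandomWorlds.minIndex (fun i : Fin n => RandomWorlds.BeliefExceeds RandomWorlds.CopyDef
        ((RandomWorlds.KB α β s t).and (RandomWorlds.KBdef i j)) lam) ≤
      RandomWorlds.minIndex (fun i : Fin n => RandomWorlds.BeliefExceeds RandomWorlds.CopyDef
        ((RandomWorlds.KB α β s t).and (RandomWorlds.KBdef i j')) lam)) ∧
    (∀ i i' : Fin n, i' ≤ i →
      RandomWorlds.minIndex (fun j : Fin m => RandomWorlds.BeliefExceeds RandomWorlds.CopyDef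
        ((RandomWorlds.KB α β s t).and (RandomWorlds.KBdef i j)) lam) ≤
      RandomWorlds.minIndex (fun j : Fin m => RandomWorlds.BeliefExceeds RandomWorlds.CopyDef
        ((RandomWorlds.KB α β s t).and (RandomWorlds.KBdef i' j)) lam)) := by
  have hdeg : ∀ i j, RandomWorlds.HasDegreeOfBelief RandomWorlds.CopyDef
      ((RandomWorlds.KB α β s t).and (RandomWorlds.KBdef i j)) (α i * β i j) := fun i j =>
    RandomWorlds.hasDegreeOfBelief_copyDef s t (hα i) (hβ i j)
  refine ⟨hdeg, fun j j' hj => RandomWorlds.minIndex_le_minIndex fun i h => ?_,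
    fun i i' hi => RandomWorlds.minIndex_le_minIndex fun j h => ?_⟩
  · rw [(hdeg _ _).beliefExceeds_iff] at h ⊢
    exact h.trans_le (mul_le_mul_of_nonneg_left (hβ_mono_ea i hj) (hα i).1)
  · rw [(hdeg _ _).beliefExceeds_iff] at h ⊢
    exact h.trans_le (mul_le_mul (hα_mono hi) (hβ_mono_sim j hi) (hβ i' j).1 (hα i).1)
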